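/- A finite-state generalized semi-Markov process (GSMP) consists of: a finite set $S$ of states; for each $s\in S$ a nonempty finite set $I(s)$ of events (each event is also a clock) and a rate $r_{s,i}>0$ for each $i\in I(s)$; a set $\mathtt{Props}(s)$ of atomic propositions for each $s$; for $i\in I(s)$, $i'\in I(s')$ a continuous probability density $f(\cdot\,;s,i;s',i')$ on $(0,\infty)$; and for $i\in I(s)$ probabilities $\mathtt{next}_i(s,s')\ge 0$ with $\sum_{s'}\mathtt{next}_i(s,s')=1$. From $\langle s,c\rangle$, where $c=(c_i)_{i\in I(s)}$ is a vector of positive clock values, each clock runs down at its rate until the first clock $i$ reaches $0$, at time $\mathcal T\langle s,c\rangle=\min_j c_j/r_{s,j}$. Then the process jumps to a state $s'$ with probability $\mathtt{next}_i(s,s')$; the clocks in $I(s')\cap(I(s)\setminus\{i\})$ keep their current values and the other clocks $i'\in I(s')$ are set independently with density $f(\cdot\,;s,i;s',i')$. A generalized state is such a pair $\langle s,c\rangle$ in which a unique clock reaches $0$ first and for which, almost surely, the same holds at every pair that the process started at $\langle s,c\rangle$ jumps to. Let $\mathcal G$ be the set of generalized states. A trace is a sequence $(g_n)_{n\ge0}$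 in $\mathcal G$ with $\sum_n\mathcal T(g_n)=\infty$; it generates the function $f:[0,\infty)\to\mathcal G$ with $f(t)=\langle s_n,c_n-r(t-\tau_n)\rangle$ for $\tau_n\le t<\tau_{n+1}$, where $g_n=\langle s_n,c_n\rangle$, $r$ is the rate vector of $s_n$ and $\tau_n=\sum_{j<n}\mathcal T(g_j)$. Let $\mathtt{Traces}(g)$ be the law, on the space of traces, of the discrete-time Markov process of successive jumps started at $g$. Let $\mathcal M$ be the set of pseudometrics $m:\mathcal G\times\mathcal G\to[0,1]$ such that $m(\langle s,c\rangle,\langle s',c'\rangle)=1$ whenever $\mathtt{Props}(s)\ne\mathtt{Props}(s')$, ordered by $m_1\preceq m_2$ iff $m_1\ge m_2$ pointwise; this is a complete lattice. For $m\in\mathcal M$ and traces generating $f,g$ put $$J(m)(f,g)=\max\Big(\sup_t\inf_{t'}\max\big(m(f(t),g(t')),|t-t'|\big),\ \sup_{t'}\inf_{t}\max\big(m(f(t),g(t')),|t-t'|\big)\Big),$$ and for probability measures $P,Q$ on traces let $W(J(m))(P,Q)=\sup_h\big(\int h\,dP-\int h\,dQ\big)$ over measurable $h$ with values in $[0,1]$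 and $|h(v)-h(w)|\le J(m)(v,w)$ for all traces $v,w$. Fix $0<k<1$. Define the monotone map $\mathcal F_k:\mathcal M\to\mathcal M$ by $\mathcal F_k(m)(x,y)=k\,W(J(m))(\mathtt{Traces}(x),\mathtt{Traces}(y))$ if the states of $x$ and $y$ have the same atomic propositions, and $\mathcal F_k(m)(x,y)=1$ otherwise. Let $m_{\mathcal F_k}$ be its maximum fixed point with respect to $\preceq$, and call $m\in\mathcal M$ a metric bisimulation if $m\preceq\mathcal F_k(m)$. **Lemma.** Writing $r_s=(r_{s,i})_{i\in I(s)}$, the formula $$m(\langle s,c\rangle,\langle s',c'\rangle)=\begin{cases}\min(1,t) & \text{if } s=s' \text{ and } c=c'+r_s t\text{ or }c=c'-r_s t\text{ for some } t\ge 0,\\ 1 & \text{otherwise}\end{cases}$$ gives a well-defined element $m$ of $\mathcal M$, and $m$ is a metric bisimulation, i.e. $m\preceq\mathcal F_k(m)$. Consequently, if $\langle s,c\rangle$ and $\langle s,c'\rangle$ are generalized states with $c=c'\pm r_s t$, $t\ge0$, then $m_{\mathcal F_k}(\langle s,c\rangle,\langle s,c'\rangle)\le\min(1,t)$. -/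

import Mathlib

open MeasureTheory ProbabilityTheory Filter
open scoped NNReal ENNReal

/-- A finite-state generalized semi-Markov process over the atomic propositions `AP`, with
events (equivalently, clocks) taken from `E`. Every state has at least one event, since
a state without events carries no generalized state. -/
structure GSMP (S E AP : Type*) [Fintype S] where
  /-- the finite set of events of a state -/
  I : S → Finset E
  I_nonempty : ∀ s, (I s).Nonempty
  /-- the rate at which a clock runs down in a state -/
  rate : (s : S) → I s → ℝ
  rate_pos : ∀ s i, 0 < rate s i
  /-- the atomic propositions that hold in a state -/
  Props : S → Set AP
  /-- `density s i s' i' t` is the density `f(t; s, i; s', i')` of the value to which the clock `i'`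
  is set when event `i` takes the process from `s` to `s'` -/
  density : (s : S) → I s → (s' : S) → I s' → ℝ → ℝ
  density_nonneg : ∀ s i s' i', ∀ t, 0 < t → 0 ≤ density s i s' i' t
  density_continuous : ∀ s i s' i', ContinuousOn (density s i s' i') (Set.Ioi 0)
  density_total : ∀ s i s' i', ∫⁻ t in Set.Ioi 0, ENNReal.ofReal (density s i s' i' t) = 1
  /-- `next s i s'` is the probability that event `i` in state `s` leads to state `s'` -/
  next : (s : S) → I s → S → ℝ
  next_nonneg : ∀ s i s', 0 ≤ next s i s'
  next_sum : ∀ s i, ∑ s', next s i s' = 1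

namespace GSMP

variable {S E AP : Type*} [Fintype S] (M : GSMP S E AP)

/-! ### Configurations and evolution -/

/-- A state together with a vector of real clock values indexed by the events of the state. -/
abbrev Config : Type _ := Σ s : S, (M.I s → ℝ)

variable {M}

/-- Clock `i` reaches `0` strictly before every other clock. -/
def IsFirst (x : M.Config) (i : M.I x.1) : Prop :=
  ∀ j, j ≠ i → x.2 i / M.rate x.1 i < x.2 j / M.rate x.1 j

/-- All clocks are running (positive), and a unique clock reaches `0` first. -/
def HasUniqueFirst (x : M.Config) : Prop :=
  (∀ j, 0 < x.2 j) ∧ ∃ i, IsFirst x i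

/-- The time required for the first clock to reach `0`. -/
noncomputable def sojourn (x : M.Config) : ℝ :=
  ⨅ i, x.2 i / M.rate x.1 i

/-- The configuration `⟨s, c - r t⟩` reached from `⟨s, c⟩` when the clocks run for time `t`. -/
def evolve (x : M.Config) (t : ℝ) : M.Config :=
  ⟨x.1, fun i => x.2 i - M.rate x.1 i * t⟩

/-! ### The transition kernel -/

variable (M) in
/-- The distribution with density `f(·; s, i; s', i')` on the positive reals. -/
noncomputable def resetLaw (s : S) (i : M.I s) (s' : S) (i' : M.I s') : Measure ℝ :=
  (volume.restrict (Set.Ioi 0)).withDensity fun t => ENNReal.ofReal (M.density s i s' i' t)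

instance (s : S) (i : M.I s) (s' : S) (i' : M.I s') :
    IsProbabilityMeasure (M.resetLaw s i s' i') :=
  ⟨by rw [resetLaw, withDensity_apply _ MeasurableSet.univ]
      simpa using M.density_total s i s' i'⟩

open Classical in
/-- The clock vector at `s'` after event `i` fires in `⟨s, c⟩`: the clocks in
`I(s') ∩ (I(s) \ {i})` carry forward the value they have at that moment, and the new clocks, those
in `I(s') \ (I(s) \ {i})`, take their values from `y`. -/
noncomputable def newClocks (s : S) (i : M.I s) (s' : S) (c : M.I s → ℝ) (y : M.I s' → ℝ) :
    M.I s' → ℝ := fun i' =>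
  if h : (i' : E) ∈ M.I s ∧ (i' : E) ≠ i then
    c ⟨i', h.1⟩ - M.rate s ⟨i', h.1⟩ * (c i / M.rate s i)
  else y i'

/-- The law of the configuration after event `i` fires in `⟨s, c⟩`: the target `s'` has
probability `next_i(s, s')`, and the new clocks are set independently. -/
noncomputable def fireLaw (s : S) (i : M.I s) (c : M.I s → ℝ) : Measure M.Config :=
  ∑ s', ENNReal.ofReal (M.next s i s') •
    (Measure.pi fun i' => M.resetLaw s i s' i').map fun y => ⟨s', newClocks s i s' c y⟩

open Classical in
/-- The law of the next configuration. Where no unique clock is first the value is a dummy,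
which no generalized state ever reaches. -/
noncomputable def jumpLaw (x : M.Config) : Measure M.Config :=
  if h : ∃ i, IsFirst x i then fireLaw x.1 h.choose x.2 else Measure.dirac x

theorem measurable_mk (s : S) :
    Measurable (fun c : M.I s → ℝ => (⟨s, c⟩ : M.Config)) :=
  fun _ h => (MeasurableSpace.measurableSet_iInf.1 h) s

theorem measurable_of_fibers {β : Type*} [MeasurableSpace β] {g : M.Config → β}
    (h : ∀ s, Measurable fun c : M.I s → ℝ => g ⟨s, c⟩) : Measurable g :=
  fun _ ht => MeasurableSpace.measurableSet_iInf.2 fun s => h s ht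

theorem measurable_newClocks (s : S) (i : M.I s) (s' : S) :
    Measurable fun p : (M.I s → ℝ) × (M.I s' → ℝ) => newClocks s i s' p.1 p.2 := by
  refine measurable_pi_lambda _ fun i' => ?_
  unfold newClocks
  split_ifs <;> fun_prop

theorem IsFirst.unique {x : M.Config} {i j : M.I x.1} (hi : IsFirst x i) (hj : IsFirst x j) :
    i = j := by
  by_contra h
  exact lt_asymm (hi j (Ne.symm h)) (hj i h)

theorem jumpLaw_of_isFirst {x : M.Config} {i : M.I x.1} (hi : IsFirst x i) :
    jumpLaw x = fireLaw x.1 i x.2 := by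
  have h : ∃ i, IsFirst x i := ⟨i, hi⟩
  rw [jumpLaw, dif_pos h, h.choose_spec.unique hi]

instance (s : S) (i : M.I s) (c : M.I s → ℝ) : IsProbabilityMeasure (fireLaw s i c) := by
  constructor
  have hm : ∀ s', Measurable fun y => (⟨s', newClocks s i s' c y⟩ : M.Config) := fun s' =>
    (measurable_mk s').comp ((measurable_newClocks s i s').comp measurable_prodMk_left)
  simp only [fireLaw, Measure.coe_finsetSum, Finset.sum_apply, Measure.smul_apply, smul_eq_mul]
  have : ∀ s', ((Measure.pi fun i' => M.resetLaw s i s' i').map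
      fun y => (⟨s', newClocks s i s' c y⟩ : M.Config)) Set.univ = 1 := fun s' => by
    rw [Measure.map_apply (hm s') MeasurableSet.univ]; simp
  simp only [this, mul_one]
  rw [← ENNReal.ofReal_sum_of_nonneg fun s' _ => M.next_nonneg s i s', M.next_sum]
  simp

instance (x : M.Config) : IsProbabilityMeasure (jumpLaw x) := by
  unfold jumpLaw
  split_ifs <;> infer_instance

theorem measurable_fireLaw (s : S) (i : M.I s) :
    Measurable (fireLaw (M := M) s i) := by
  refine Measure.measurable_of_measurable_coe _ fun B hB => ?_
  have hm : ∀ s', Measurable fun p : (M.I s → ℝ) × (M.I s' → ℝ) =>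
      (⟨s', newClocks s i s' p.1 p.2⟩ : M.Config) := fun s' =>
    (measurable_mk s').comp (measurable_newClocks s i s')
  simp only [fireLaw, Measure.coe_finsetSum, Finset.sum_apply, Measure.smul_apply, smul_eq_mul]
  refine Finset.measurable_sum _ fun s' _ => Measurable.const_mul ?_ _
  have : ∀ c, ((Measure.pi fun i' => M.resetLaw s i s' i').map
      fun y => (⟨s', newClocks s i s' c y⟩ : M.Config)) B =
      (Measure.pi fun i' => M.resetLaw s i s' i')
        (Prod.mk c ⁻¹' ((fun p : (M.I s → ℝ) × (M.I s' → ℝ) =>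
          (⟨s', newClocks s i s' p.1 p.2⟩ : M.Config)) ⁻¹' B)) := fun c =>
    Measure.map_apply ((hm s').comp measurable_prodMk_left) hB
  simp only [this]
  exact measurable_measure_prodMk_left (hm s' hB)

theorem measurableSet_isFirst (s : S) (i : M.I s) :
    MeasurableSet {c : M.I s → ℝ | IsFirst (⟨s, c⟩ : M.Config) i} := by
  simp only [IsFirst, Set.ofPred_forall]
  refine MeasurableSet.iInter fun j => MeasurableSet.iInter fun _ => ?_
  exact measurableSet_lt (by fun_prop) (by fun_prop)

theorem measurable_jumpLaw : Measurable (jumpLaw (M := M)) := by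
  refine measurable_of_fibers fun s B hB => ?_
  have key : (fun c : M.I s → ℝ => jumpLaw (⟨s, c⟩ : M.Config)) ⁻¹' B =
      (⋃ i : M.I s, {c : M.I s → ℝ | IsFirst (⟨s, c⟩ : M.Config) i} ∩ fireLaw s i ⁻¹' B) ∪
      ((⋃ i : M.I s, {c : M.I s → ℝ | IsFirst (⟨s, c⟩ : M.Config) i})ᶜ ∩
        (fun c => Measure.dirac (⟨s, c⟩ : M.Config)) ⁻¹' B) := by
    ext c
    by_cases h : ∃ i, IsFirst (⟨s, c⟩ : M.Config) i
    · obtain ⟨i, hi⟩ := h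
      simp only [Set.mem_preimage, jumpLaw_of_isFirst hi, Set.mem_union, Set.mem_iUnion,
        Set.mem_inter_iff, Set.mem_ofPred_eq, Set.mem_compl_iff]
      constructor
      · exact fun hB => Or.inl ⟨i, hi, hB⟩
      · rintro (⟨j, hj, hB⟩ | ⟨hn, _⟩)
        · rwa [hi.unique hj]
        · exact absurd ⟨i, hi⟩ hn
    · simp only [Set.mem_preimage, jumpLaw, dif_neg h, Set.mem_union, Set.mem_iUnion,
        Set.mem_inter_iff, Set.mem_ofPred_eq, Set.mem_compl_iff]
      constructor
      · exact fun hB => Or.inr ⟨h, hB⟩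
      · rintro (⟨j, hj, _⟩ | ⟨_, hB⟩)
        · exact absurd ⟨j, hj⟩ h
        · exact hB
  rw [key]
  have hU : MeasurableSet (⋃ i : M.I s, {c : M.I s → ℝ | IsFirst (⟨s, c⟩ : M.Config) i}) :=
    MeasurableSet.iUnion fun i => measurableSet_isFirst s i
  exact (MeasurableSet.iUnion fun i => (measurableSet_isFirst s i).inter
    (measurable_fireLaw s i hB)).union
    (hU.compl.inter ((Measure.measurable_dirac.comp (measurable_mk s)) hB))

variable (M) in
/-- The transition kernel of the embedded discrete-time Markov process. -/
noncomputable def jumpKernel : Kernel M.Config M.Config where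
  toFun := jumpLaw
  measurable' := measurable_jumpLaw

instance : IsMarkovKernel M.jumpKernel :=
  ⟨fun x => inferInstanceAs (IsProbabilityMeasure (jumpLaw x))⟩

variable (M) in
/-- The same kernel, with the current configuration read off a finite history. -/
noncomputable def historyKernel (n : ℕ) :
    Kernel ((_ : Finset.Iic n) → M.Config) M.Config :=
  M.jumpKernel.comap (fun h => h ⟨n, Finset.mem_Iic.2 le_rfl⟩) (measurable_pi_apply _)

instance (n : ℕ) : IsMarkovKernel (M.historyKernel n) := by
  unfold historyKernel; infer_instance

/-- The law of the Markov process started at `x`, on sequences of configurations. -/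
noncomputable def seqLaw (x : M.Config) : Measure (ℕ → M.Config) :=
  Kernel.traj (X := fun _ => M.Config) M.historyKernel 0 fun _ => x

instance (x : M.Config) : IsProbabilityMeasure (seqLaw x) := by
  unfold seqLaw; infer_instance

/-! ### Generalized states -/

/-- During the first `n` jumps the uniqueness condition holds, almost surely. -/
def UniqueUpTo : ℕ → M.Config → Prop
  | 0, x => HasUniqueFirst x
  | n + 1, x => HasUniqueFirst x ∧ ∀ᵐ y ∂(M.jumpKernel x), UniqueUpTo n y

/-- `x` satisfies the uniqueness condition, and almost surely so does every configuration that the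
process started at `x` jumps to, so that the evolution from `x` is defined for ever. -/
def IsGenState (x : M.Config) : Prop := ∀ n, UniqueUpTo n x

variable (M) in
/-- The generalized states `⟨s, c⟩`. -/
abbrev GenState : Type _ := {x : M.Config // IsGenState x}

theorem IsGenState.hasUniqueFirst {x : M.Config} (hx : IsGenState x) : HasUniqueFirst x := hx 0

instance (s : S) : Nonempty (M.I s) := (M.I_nonempty s).to_subtype

theorem sojourn_le (x : M.Config) (i : M.I x.1) : sojourn x ≤ x.2 i / M.rate x.1 i :=
  ciInf_le (Set.finite_range _).bddBelow i

theorem sojourn_pos {x : M.Config} (hx : HasUniqueFirst x) : 0 < sojourn x := by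
  obtain ⟨i, hi⟩ := exists_eq_ciInf_of_finite (f := fun i => x.2 i / M.rate x.1 i)
  rw [sojourn, ← hi]
  exact div_pos (hx.1 i) (M.rate_pos _ i)

theorem isFirst_evolve {x : M.Config} (t : ℝ) {i : M.I x.1} (hi : IsFirst x i) :
    IsFirst (evolve x t) i := by
  intro j hj
  have hr := fun i => (M.rate_pos x.1 i).ne'
  have := hi j hj
  have e : ∀ i : M.I x.1, (x.2 i - M.rate x.1 i * t) / M.rate x.1 i
      = x.2 i / M.rate x.1 i - t := fun i => by
    rw [sub_div, mul_div_cancel_left₀ _ (hr i)]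
  change (x.2 i - M.rate x.1 i * t) / M.rate x.1 i < (x.2 j - M.rate x.1 j * t) / M.rate x.1 j
  have ej := e j
  have ei := e i
  linarith

theorem newClocks_evolve (s : S) (i : M.I s) (s' : S) (c : M.I s → ℝ) (t : ℝ)
    (y : M.I s' → ℝ) :
    newClocks s i s' (fun j => c j - M.rate s j * t) y = newClocks s i s' c y := by
  funext i'
  unfold newClocks
  split_ifs with h
  · have := (M.rate_pos s i).ne'
    field_simp
    ring
  · rfl

theorem jumpLaw_evolve {x : M.Config} (hx : HasUniqueFirst x) (t : ℝ) :
    jumpLaw (evolve x t) = jumpLaw x := by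
  obtain ⟨i, hi⟩ := hx.2
  rw [jumpLaw_of_isFirst hi, jumpLaw_of_isFirst (isFirst_evolve t hi)]
  simp only [fireLaw, evolve, newClocks_evolve]

/-- Generalized states remain such while their clocks run. -/
theorem isGenState_evolve {x : M.Config} (hx : IsGenState x) {t : ℝ} (ht : t < sojourn x) :
    IsGenState (evolve x t) := by
  have h0 : HasUniqueFirst (evolve x t) := by
    refine ⟨fun j => ?_, ?_⟩
    · have := ht.trans_le (sojourn_le x j)
      rw [lt_div_iff₀ (M.rate_pos x.1 j)] at this
      change 0 < x.2 j - M.rate x.1 j * t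
      linarith
    · obtain ⟨i, hi⟩ := (hx 0).2
      exact ⟨i, isFirst_evolve t hi⟩
  intro n
  cases n with
  | zero => exact h0
  | succ n =>
    refine ⟨h0, ?_⟩
    have e : M.jumpKernel (evolve x t) = M.jumpKernel x := jumpLaw_evolve (hx 0) t
    rw [e]
    exact (hx (n + 1)).2

/-! ### Traces -/

/-- The time of the `n`-th jump of a sequence of generalized states. -/
noncomputable def jumpTime (w : ℕ → M.GenState) (n : ℕ) : ℝ :=
  ∑ j ∈ Finset.range n, sojourn (w j).1

variable (M) in
/-- The finitely varying (non-Zeno) sequences of generalized states. -/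
abbrev Trace : Type _ := {w : ℕ → M.GenState // Tendsto (jumpTime w) atTop atTop}

theorem Trace.exists_lt (w : M.Trace) (t : ℝ≥0) : ∃ n, (t : ℝ) < jumpTime w.1 (n + 1) :=
  (((tendsto_add_atTop_iff_nat 1).2 w.2).eventually_gt_atTop (t : ℝ)).exists

open Classical in
/-- The number of jumps up to time `t`. -/
noncomputable def Trace.index (w : M.Trace) (t : ℝ≥0) : ℕ := Nat.find (w.exists_lt t)

theorem Trace.index_spec (w : M.Trace) (t : ℝ≥0) :
    jumpTime w.1 (w.index t) ≤ t ∧ (t : ℝ) < jumpTime w.1 (w.index t + 1) := by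
  classical
  refine ⟨?_, Nat.find_spec (w.exists_lt t)⟩
  rcases h : w.index t with _ | n
  · simp [jumpTime]
  · have : n < Nat.find (w.exists_lt t) := by
      change n < w.index t
      omega
    exact not_lt.1 (Nat.find_min (w.exists_lt t) this)

/-- The function `[0, ∞) → 𝒢` generated by a finitely varying sequence. -/
noncomputable def Trace.toFun (w : M.Trace) (t : ℝ≥0) : M.GenState :=
  ⟨evolve (w.1 (w.index t)).1 (t - jumpTime w.1 (w.index t)),
    isGenState_evolve (w.1 _).2 (by
      have h := (w.index_spec t).2
      rw [jumpTime, Finset.sum_range_succ, ← jumpTime] at h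
      linarith)⟩

/-- The sequence of configurations underlying a trace. -/
def Trace.toSeq (w : M.Trace) : ℕ → M.Config := fun n => (w.1 n).1

/-- The probability distribution `Traces⟨s, c⟩` on the finitely varying sequences, that is, the law
of the Markov process started at `g`, restricted to the (almost sure) set of such sequences. -/
noncomputable def traces (g : M.GenState) : Measure M.Trace :=
  (seqLaw g.1).comap Trace.toSeq

theorem measurable_sojourn : Measurable (sojourn (M := M)) :=
  measurable_of_fibers fun s => by
    change Measurable fun c : M.I s → ℝ => ⨅ i : M.I s, c i / M.rate s i
    exact Measurable.iInf fun i => by fun_prop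

theorem measurableSet_uniqueUpTo (n : ℕ) : MeasurableSet {x : M.Config | UniqueUpTo n x} := by
  have h0 : MeasurableSet {x : M.Config | HasUniqueFirst x} := by
    refine MeasurableSpace.measurableSet_iInf.2 fun s => ?_
    change MeasurableSet {c : M.I s → ℝ | (∀ j, 0 < c j) ∧ ∃ i, IsFirst (⟨s, c⟩ : M.Config) i}
    simp only [Set.ofPred_and, Set.ofPred_forall, Set.ofPred_exists]
    exact (MeasurableSet.iInter fun j => measurableSet_lt measurable_const
      (measurable_pi_apply j)).inter (MeasurableSet.iUnion fun i => measurableSet_isFirst s i)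
  induction n with
  | zero => exact h0
  | succ n ih =>
    have : {x : M.Config | UniqueUpTo (n + 1) x} = {x | HasUniqueFirst x} ∩
        {x | M.jumpKernel x {y | UniqueUpTo n y}ᶜ = 0} := rfl
    rw [this]
    exact h0.inter ((M.jumpKernel.measurable_coe ih.compl) (measurableSet_singleton 0))

/-- So `Measure.comap` along `Trace.toSeq` is the restriction of a measure to a measurable set. -/
theorem measurableEmbedding_toSeq : MeasurableEmbedding (Trace.toSeq (M := M)) := by
  have hG : MeasurableSet {x : M.Config | IsGenState x} := by
    simp only [IsGenState, Set.ofPred_forall]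
    exact MeasurableSet.iInter measurableSet_uniqueUpTo
  have h1 : MeasurableEmbedding (fun w : M.Trace => w.1) := by
    refine MeasurableEmbedding.subtype_coe ?_
    have hj : ∀ n, Measurable fun w : ℕ → M.GenState => jumpTime w n := fun n =>
      Finset.measurable_sum _ fun j _ =>
        measurable_sojourn.comp (measurable_subtype_coe.comp (measurable_pi_apply j))
    have : {w : ℕ → M.GenState | Tendsto (jumpTime w) atTop atTop} =
        {w | ∀ b : ℕ, ∃ i, ∀ a, i ≤ a → (b : ℝ) ≤ jumpTime w a} := by
      ext w
      rw [Set.mem_ofPred_eq, tendsto_atTop_atTop]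
      constructor
      · exact fun h b => h b
      · intro h b
        obtain ⟨n, hn⟩ := exists_nat_ge b
        obtain ⟨i, hi⟩ := h n
        exact ⟨i, fun a ha => hn.trans (hi a ha)⟩
    change MeasurableSet {w : ℕ → M.GenState | Tendsto (jumpTime w) atTop atTop}
    rw [this]
    simp only [Set.ofPred_forall, Set.ofPred_exists]
    exact MeasurableSet.iInter fun b => MeasurableSet.iUnion fun i => MeasurableSet.iInter fun a =>
      MeasurableSet.iInter fun _ => measurableSet_le measurable_const (hj a)
  have h2 : MeasurableEmbedding (fun (w : ℕ → M.GenState) (n : ℕ) => (w n).1) := by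
    refine ⟨fun v w h => funext fun n => Subtype.ext (congrFun h n),
      measurable_pi_lambda _ fun n => measurable_subtype_coe.comp (measurable_pi_apply n), ?_⟩
    intro A hA
    have hr : MeasurableSet {v : ℕ → M.Config | ∀ n, IsGenState (v n)} := by
      simp only [Set.ofPred_forall]
      exact MeasurableSet.iInter fun n => (measurable_pi_apply n : Measurable fun v : ℕ → M.Config => v n) hG
    let F : {v : ℕ → M.Config // ∀ n, IsGenState (v n)} → (ℕ → M.GenState) :=
      fun v n => ⟨v.1 n, v.2 n⟩
    have hF : Measurable F := measurable_pi_lambda _ fun n =>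
      Measurable.subtype_mk ((measurable_pi_apply n).comp measurable_subtype_coe)
    have : (fun (w : ℕ → M.GenState) (n : ℕ) => (w n).1) '' A = Subtype.val '' (F ⁻¹' A) := by
      ext v
      constructor
      · rintro ⟨w, hw, rfl⟩
        exact ⟨⟨fun n => (w n).1, fun n => (w n).2⟩, hw, rfl⟩
      · rintro ⟨v, hv, rfl⟩
        exact ⟨F v, hv, rfl⟩
    rw [this]
    exact (MeasurableEmbedding.subtype_coe hr).measurableSet_image.2 (hF hA)
  exact h2.comp h1

theorem traces_univ_le (g : M.GenState) : traces g Set.univ ≤ 1 :=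
  (Measure.comap_apply_le _ _ MeasurableSet.univ.nullMeasurableSet).trans prob_le_one

instance (g : M.GenState) : IsFiniteMeasure (traces g) :=
  ⟨(traces_univ_le g).trans_lt ENNReal.one_lt_top⟩

/-! ### The lattice of pseudometrics -/

variable (M) in
/-- The class `𝓜` of `[0, 1]`-valued pseudometrics on generalized states that give distance `1` to
generalized states with different atomic propositions. -/
@[ext]
structure PMet where
  dist : M.GenState → M.GenState → ℝ
  nonneg : ∀ x y, 0 ≤ dist x y
  le_one : ∀ x y, dist x y ≤ 1
  self : ∀ x, dist x x = 0
  symm : ∀ x y, dist x y = dist y x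
  triangle : ∀ x y z, dist x z ≤ dist x y + dist y z
  props : ∀ x y, M.Props x.1.1 ≠ M.Props y.1.1 → dist x y = 1

instance : CoeFun M.PMet fun _ => M.GenState → M.GenState → ℝ := ⟨PMet.dist⟩

/-- The order `⪯`: larger elements assign smaller distances. -/
instance : PartialOrder M.PMet where
  le m₁ m₂ := ∀ x y, m₂ x y ≤ m₁ x y
  le_refl _ _ _ := le_rfl
  le_trans _ _ _ h₁ h₂ x y := (h₂ x y).trans (h₁ x y)
  le_antisymm _ _ h₁ h₂ := PMet.ext (funext₂ fun x y => le_antisymm (h₂ x y) (h₁ x y))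

open Classical in
variable (M) in
/-- The top element: distance `0` unless the atomic propositions differ. -/
noncomputable def topPMet : M.PMet where
  dist x y := if M.Props x.1.1 = M.Props y.1.1 then 0 else 1
  nonneg x y := by split_ifs <;> norm_num
  le_one x y := by split_ifs <;> norm_num
  self x := by simp
  symm x y := by simp only [eq_comm]
  triangle x y z := by
    by_cases h₁ : M.Props x.1.1 = M.Props y.1.1
    · simp [h₁]
    · by_cases h₂ : M.Props y.1.1 = M.Props z.1.1
      · simp [← h₂, h₁]
      · simp only [h₁, h₂, if_false]
        split_ifs <;> norm_num
  props x y h := by simp [h]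

theorem le_topPMet (m : M.PMet) : m ≤ M.topPMet := fun x y => by
  by_cases h : M.Props x.1.1 = M.Props y.1.1
  · simpa [topPMet, h] using m.nonneg x y
  · rw [M.topPMet.props x y h, m.props x y h]

theorem PMet.bdd (A : Set M.PMet) (x y : M.GenState) :
    BddAbove (Set.range fun m : A => m.1 x y) :=
  ⟨1, by rintro _ ⟨m, rfl⟩; exact m.1.le_one x y⟩

/-- The infimum of a nonempty family is its pointwise supremum. -/
noncomputable def PMet.infOf (A : Set M.PMet) (hA : Nonempty A) : M.PMet where
  dist x y := ⨆ m : A, m.1 x y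
  nonneg x y := Real.iSup_nonneg fun m => m.1.nonneg x y
  le_one x y := ciSup_le fun m => m.1.le_one x y
  self x := by simp [PMet.self]
  symm x y := by simp only [PMet.symm _ x y]
  triangle x y z := ciSup_le fun m => (m.1.triangle x y z).trans
    (add_le_add (le_ciSup (PMet.bdd A x y) m) (le_ciSup (PMet.bdd A y z) m))
  props x y h := by simp [PMet.props _ x y h]

noncomputable instance : InfSet M.PMet :=
  ⟨fun A => PMet.infOf (insert M.topPMet A) ⟨M.topPMet, Set.mem_insert _ _⟩⟩

theorem PMet.isGLB_sInf (A : Set M.PMet) : IsGLB A (sInf A) := by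
  constructor
  · exact fun m hm x y => le_ciSup (PMet.bdd (insert M.topPMet A) x y) ⟨m, Set.mem_insert_of_mem _ hm⟩
  · intro n hn x y
    have : Nonempty ↥(insert M.topPMet A) := ⟨M.topPMet, Set.mem_insert _ _⟩
    refine ciSup_le ?_
    rintro ⟨m, rfl | hm⟩
    · exact le_topPMet n x y
    · exact hn hm x y

noncomputable instance : CompleteLattice M.PMet := completeLatticeOfInf _ PMet.isGLB_sInf

/-! ### The Skorohod `J₂` and Wasserstein liftings -/

/-- The Skorohod `J₂` distance between the functions generated by two traces. -/
noncomputable def skorohod (m : M.PMet) (v w : M.Trace) : ℝ :=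
  max (⨆ t : ℝ≥0, ⨅ t' : ℝ≥0, max (m (v.toFun t) (w.toFun t')) |(t : ℝ) - t'|)
    (⨆ t' : ℝ≥0, ⨅ t : ℝ≥0, max (m (v.toFun t) (w.toFun t')) |(t : ℝ) - t'|)

/-- The (measurable) test functions `h : Trace → [0, 1]` with `|h v - h w| ≤ d v w`. -/
structure IsTest (d : M.Trace → M.Trace → ℝ) (h : M.Trace → ℝ) : Prop where
  measurable : Measurable h
  mem : ∀ v, h v ∈ Set.Icc (0 : ℝ) 1
  lip : ∀ v w, |h v - h w| ≤ d v w

/-- The Wasserstein distance `sup_h (∫ h dP - ∫ h dQ)` over all test functions. The absolute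
value does not change it for probability measures, as one may replace `h` by `1 - h`. -/
noncomputable def wasserstein (d : M.Trace → M.Trace → ℝ) (P Q : Measure M.Trace) : ℝ :=
  ⨆ h : {h : M.Trace → ℝ // IsTest d h}, |∫ v, h.1 v ∂P - ∫ v, h.1 v ∂Q|

theorem skorohod_inf_le (m : M.PMet) (v w : M.Trace) :
    (∀ t : ℝ≥0, ⨅ t' : ℝ≥0, max (m (v.toFun t) (w.toFun t')) |(t : ℝ) - t'| ≤ 1) ∧
    (∀ t' : ℝ≥0, ⨅ t : ℝ≥0, max (m (v.toFun t) (w.toFun t')) |(t : ℝ) - t'| ≤ 1) := by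
  constructor
  · intro t
    refine (ciInf_le ⟨0, ?_⟩ t).trans ?_
    · rintro _ ⟨t', rfl⟩; exact le_max_of_le_right (abs_nonneg _)
    · simpa using m.le_one _ _
  · intro t
    refine (ciInf_le ⟨0, ?_⟩ t).trans ?_
    · rintro _ ⟨t', rfl⟩; exact le_max_of_le_right (abs_nonneg _)
    · simpa using m.le_one _ _

theorem skorohod_mono {m₁ m₂ : M.PMet} (h : m₁ ≤ m₂) (v w : M.Trace) :
    skorohod m₂ v w ≤ skorohod m₁ v w := by
  refine max_le_max (ciSup_mono ⟨1, ?_⟩ fun t => ciInf_mono ⟨0, ?_⟩ fun t' => ?_)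
    (ciSup_mono ⟨1, ?_⟩ fun t => ciInf_mono ⟨0, ?_⟩ fun t' => ?_)
  · rintro _ ⟨t, rfl⟩; exact (skorohod_inf_le m₁ v w).1 t
  · rintro _ ⟨t', rfl⟩; exact le_max_of_le_right (abs_nonneg _)
  · exact max_le_max (h _ _) le_rfl
  · rintro _ ⟨t, rfl⟩; exact (skorohod_inf_le m₁ v w).2 t
  · rintro _ ⟨t', rfl⟩; exact le_max_of_le_right (abs_nonneg _)
  · exact max_le_max (h _ _) le_rfl

theorem skorohod_nonneg (m : M.PMet) (v w : M.Trace) : 0 ≤ skorohod m v w :=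
  le_max_of_le_left (Real.iSup_nonneg fun _ => Real.iInf_nonneg fun _ =>
    le_max_of_le_right (abs_nonneg _))

theorem isTest_zero (m : M.PMet) : IsTest (skorohod m) fun _ => 0 :=
  ⟨measurable_const, fun _ => by simp, fun v w => by simpa using skorohod_nonneg m v w⟩

theorem IsTest.integral_mem {d : M.Trace → M.Trace → ℝ} {h : M.Trace → ℝ} (hh : IsTest d h)
    (g : M.GenState) : ∫ v, h v ∂(traces g) ∈ Set.Icc (0 : ℝ) 1 := by
  refine ⟨integral_nonneg fun v => (hh.mem v).1, ?_⟩
  have h1 : ∫ v, h v ∂(traces g) ≤ ∫ _, (1 : ℝ) ∂(traces g) := by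
    refine integral_mono_of_nonneg (ae_of_all _ fun v => (hh.mem v).1) (integrable_const _)
      (ae_of_all _ fun v => (hh.mem v).2)
  refine h1.trans ?_
  rw [integral_const, smul_eq_mul, mul_one]
  exact ENNReal.toReal_le_of_le_ofReal zero_le_one (by simpa using traces_univ_le g)

theorem IsTest.abs_sub_le_one {d : M.Trace → M.Trace → ℝ} {h : M.Trace → ℝ} (hh : IsTest d h)
    (x y : M.GenState) : |∫ v, h v ∂(traces x) - ∫ v, h v ∂(traces y)| ≤ 1 := by
  have hx := hh.integral_mem x
  have hy := hh.integral_mem y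
  rw [abs_le]
  constructor <;> linarith [hx.1, hx.2, hy.1, hy.2]

theorem wasserstein_bdd (d : M.Trace → M.Trace → ℝ) (x y : M.GenState) :
    BddAbove (Set.range fun h : {h : M.Trace → ℝ // IsTest d h} =>
      |∫ v, h.1 v ∂(traces x) - ∫ v, h.1 v ∂(traces y)|) :=
  ⟨1, by rintro _ ⟨h, rfl⟩; exact h.2.abs_sub_le_one x y⟩

theorem wasserstein_nonneg (d : M.Trace → M.Trace → ℝ) (P Q : Measure M.Trace) :
    0 ≤ wasserstein d P Q :=
  Real.iSup_nonneg fun _ => abs_nonneg _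

theorem wasserstein_le_one (d : M.Trace → M.Trace → ℝ) (x y : M.GenState) :
    wasserstein d (traces x) (traces y) ≤ 1 :=
  Real.iSup_le (fun h => h.2.abs_sub_le_one x y) zero_le_one

theorem wasserstein_triangle (d : M.Trace → M.Trace → ℝ) (x y z : M.GenState) :
    wasserstein d (traces x) (traces z) ≤
      wasserstein d (traces x) (traces y) + wasserstein d (traces y) (traces z) :=
  Real.iSup_le (fun h => (abs_sub_le _ (∫ v, h.1 v ∂(traces y)) _).trans
      (add_le_add (le_ciSup (wasserstein_bdd d x y) h) (le_ciSup (wasserstein_bdd d y z) h)))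
    (add_nonneg (wasserstein_nonneg _ _ _) (wasserstein_nonneg _ _ _))

theorem wasserstein_mono {m₁ m₂ : M.PMet} (h : m₁ ≤ m₂) (x y : M.GenState) :
    wasserstein (skorohod m₂) (traces x) (traces y) ≤
      wasserstein (skorohod m₁) (traces x) (traces y) :=
  Real.iSup_le (fun f => le_ciSup (wasserstein_bdd (skorohod m₁) x y)
      ⟨f.1, f.2.measurable, f.2.mem, fun v w => (f.2.lip v w).trans (skorohod_mono h v w)⟩)
    (wasserstein_nonneg _ _ _)

/-! ### The functional `F_k` and metric bisimulations -/

open Classical in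
/-- `F_k(m) = k · W(J(m))`, with distance `1` where the atomic propositions differ, as membership in
`𝓜` demands. -/
noncomputable def bisimFun (k : ℝ) (hk : 0 < k ∧ k < 1) (m : M.PMet) : M.PMet where
  dist x y := if M.Props x.1.1 = M.Props y.1.1
    then k * wasserstein (skorohod m) (traces x) (traces y) else 1
  nonneg x y := by
    split_ifs
    · exact mul_nonneg hk.1.le (wasserstein_nonneg _ _ _)
    · exact zero_le_one
  le_one x y := by
    split_ifs
    · exact mul_le_one₀ hk.2.le (wasserstein_nonneg _ _ _) (wasserstein_le_one _ _ _)
    · exact le_rfl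
  self x := by simp [wasserstein]
  symm x y := by simp only [wasserstein, abs_sub_comm, eq_comm]
  triangle x y z := by
    have h0 := fun a b : M.GenState => mul_nonneg hk.1.le
      (wasserstein_nonneg (skorohod m) (traces a) (traces b))
    have h1 := mul_le_one₀ hk.2.le (wasserstein_nonneg _ _ _)
      (wasserstein_le_one (skorohod m) x z)
    have h2 := mul_le_mul_of_nonneg_left (wasserstein_triangle (skorohod m) x y z) hk.1.le
    have h3 := h0 x y
    have h4 := h0 y z
    by_cases hxy : M.Props x.1.1 = M.Props y.1.1 <;> by_cases hyz : M.Props y.1.1 = M.Props z.1.1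
    · simp only [hxy.trans hyz, hyz, if_true]
      linarith
    · simp only [hxy, hyz, if_true, if_false]
      linarith
    · rw [← hyz]
      simp only [hxy, if_true, if_false]
      linarith
    · simp only [hxy, hyz, if_false]
      split_ifs <;> linarith
  props x y h := by simp [h]

/-- `F_k` as a monotone functional on `𝓜`. -/
noncomputable def bisimHom (k : ℝ) (hk : 0 < k ∧ k < 1) : M.PMet →o M.PMet where
  toFun := bisimFun k hk
  monotone' m₁ m₂ h x y := by
    by_cases hp : M.Props x.1.1 = M.Props y.1.1
    · simpa [bisimFun, hp] using mul_le_mul_of_nonneg_left (wasserstein_mono h x y) hk.1.le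
    · rw [(bisimFun k hk m₁).props x y hp, (bisimFun k hk m₂).props x y hp]

/-- `m` is a metric bisimulation: `m ⪯ F_k(m)`. -/
def IsMetricBisim (k : ℝ) (hk : 0 < k ∧ k < 1) (m : M.PMet) : Prop := m ≤ bisimHom k hk m

variable (M) in
/-- `m_{F_k}`, the maximum fixed point of `F_k`. -/
noncomputable def maxBisim (k : ℝ) (hk : 0 < k ∧ k < 1) : M.PMet := (bisimHom k hk).gfp

/-- The two generalized states have the same state, and their clock vectors differ by evolution for
time `t`: `c = c' + r t` or `c = c' - r t`. -/
def TimeShifted (t : ℝ) (x y : M.GenState) : Prop :=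
  x.1 = evolve y.1 (-t) ∨ x.1 = evolve y.1 t

end GSMP

namespace GSMP

variable {S E AP : Type*} [Fintype S] {M : GSMP S E AP}

/-! ### Evolution and the time-shift pseudometric -/

/-! Let `x` be `y` after its clocks have run for time `t ≥ 0`. The same clock is first in both, and
at the moment it fires the surviving clocks have the same values, so `jumpLaw x = jumpLaw y`. The
processes from `x` and `y` therefore differ only in their initial entry: a single random trace with
its head overwritten by `x` or by `y` has the law of either (`seqLaw_map_update`,
`traces_map_setHead`).

Under this coupling the two generated functions are delays of each other: the one from `y` at time
`τ + t` equals the one from `x` at time `τ` (`Trace.toFun_setHead_shift`), while at `τ < t` the one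
from `y` is a shift by `t - τ` of the value `x` at time `0`. Hence their Skorohod distance is at
most `min 1 t` for every outcome (`skorohod_setHead_le`), and integrating a test function against
the coupling bounds the Wasserstein distance by the same number. The factor `k < 1` only helps, and
pairs that are not time shifts have distance `1`, where nothing is to be shown. The bound on the
maximum fixed point is then Knaster–Tarski.

Only total mass at most `1` of `traces` is used: both laws are images of one measure, so almost sure
non-Zenoness plays no role. -/

theorem evolve_zero (x : M.Config) : evolve x 0 = x := by simp [evolve]

theorem evolve_evolve (x : M.Config) (a b : ℝ) : evolve (evolve x a) b = evolve x (a + b) := by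
  simp only [evolve]
  congr 1
  funext i
  ring

/-- A state has at least one clock, and it runs at a nonzero rate, so a single clock value recovers
the elapsed time. This makes the choice of `t` in `shiftDist` harmless. -/
theorem evolve_injective (x : M.Config) : Function.Injective (evolve x) := by
  intro a b h
  have h2 := congrFun (eq_of_heq (Sigma.mk.inj_iff.1 h).2)
  obtain ⟨i⟩ : Nonempty (M.I x.1) := inferInstance
  have := h2 i
  have hr := (M.rate_pos x.1 i).ne'
  exact mul_left_cancel₀ hr (by linarith)

theorem sojourn_evolve (x : M.Config) (t : ℝ) : sojourn (evolve x t) = sojourn x - t := by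
  have e : ∀ i : M.I x.1, (x.2 i - M.rate x.1 i * t) / M.rate x.1 i
      = x.2 i / M.rate x.1 i - t := fun i => by
    rw [sub_div, mul_div_cancel_left₀ _ (M.rate_pos x.1 i).ne']
  change ⨅ i : M.I x.1, (x.2 i - M.rate x.1 i * t) / M.rate x.1 i = _
  simp only [e]
  exact (ciInf_sub (Set.finite_range _).bddBelow t).symm

theorem eq_evolve_neg {x y : M.Config} {t : ℝ} (h : x = evolve y t) : y = evolve x (-t) := by
  rw [h, evolve_evolve, add_neg_cancel, evolve_zero]

open Classical in
/-- The distance `min 1 |t|` between configurations that differ by evolution for time `t`, and `1`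
between all others. -/
noncomputable def shiftDist (x y : M.Config) : ℝ :=
  if h : ∃ t, x = evolve y t then min 1 |h.choose| else 1

theorem shiftDist_eq {x y : M.Config} {t : ℝ} (h : x = evolve y t) :
    shiftDist x y = min 1 |t| := by
  have h' : ∃ t, x = evolve y t := ⟨t, h⟩
  rw [shiftDist, dif_pos h', evolve_injective y (h'.choose_spec.symm.trans h)]

theorem shiftDist_eq_one {x y : M.Config} (h : ¬ ∃ t, x = evolve y t) : shiftDist x y = 1 :=
  dif_neg h

theorem shiftDist_nonneg (x y : M.Config) : 0 ≤ shiftDist x y := by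
  unfold shiftDist
  split_ifs
  · exact le_min zero_le_one (abs_nonneg _)
  · exact zero_le_one

theorem shiftDist_le_one (x y : M.Config) : shiftDist x y ≤ 1 := by
  unfold shiftDist
  split_ifs
  · exact min_le_left _ _
  · exact le_rfl

theorem shiftDist_comm (x y : M.Config) : shiftDist x y = shiftDist y x := by
  by_cases h : ∃ t, x = evolve y t
  · obtain ⟨t, ht⟩ := h
    rw [shiftDist_eq ht, shiftDist_eq (eq_evolve_neg ht), abs_neg]
  · rw [shiftDist_eq_one h, shiftDist_eq_one fun ⟨t, ht⟩ => h ⟨-t, eq_evolve_neg ht⟩]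

/-- Shifts compose by adding their times, so this is the triangle inequality for `|·|` truncated at
`1`. If either intermediate pair is not a shift, the right side is already at least `1`. -/
theorem shiftDist_triangle (x y z : M.Config) :
    shiftDist x z ≤ shiftDist x y + shiftDist y z := by
  by_cases hxy : ∃ t, x = evolve y t
  · by_cases hyz : ∃ t, y = evolve z t
    · obtain ⟨a, ha⟩ := hxy
      obtain ⟨b, hb⟩ := hyz
      have hc : x = evolve z (b + a) := by rw [ha, hb, evolve_evolve]
      rw [shiftDist_eq ha, shiftDist_eq hb, shiftDist_eq hc]
      have := abs_add_le b a
      have := abs_nonneg a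
      have := abs_nonneg b
      rcases min_cases 1 |a| with h1 | h1 <;> rcases min_cases 1 |b| with h2 | h2 <;>
        rcases min_cases 1 |b + a| with h3 | h3 <;> linarith
    · rw [shiftDist_eq_one hyz]
      linarith [shiftDist_le_one x z, shiftDist_nonneg x y]
  · rw [shiftDist_eq_one hxy]
    linarith [shiftDist_le_one x z, shiftDist_nonneg y z]

variable (M) in
/-- The time-shift distance as an element of `𝓜`. -/
noncomputable def shiftPMet : M.PMet where
  dist x y := shiftDist x.1 y.1
  nonneg x y := shiftDist_nonneg _ _
  le_one x y := shiftDist_le_one _ _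
  self x := by simp [shiftDist_eq (evolve_zero x.1).symm]
  symm x y := shiftDist_comm _ _
  triangle x y z := shiftDist_triangle _ _ _
  props x y h := shiftDist_eq_one fun ⟨t, ht⟩ => h (by rw [ht]; rfl)

theorem shiftPMet_eq {x y : M.GenState} {t : ℝ} (h : x.1 = evolve y.1 t) :
    M.shiftPMet x y = min 1 |t| := shiftDist_eq h

theorem shiftPMet_of_timeShifted {x y : M.GenState} {t : ℝ} (ht : 0 ≤ t)
    (h : TimeShifted t x y) : M.shiftPMet x y = min 1 t := by
  rcases h with h | h
  · rw [shiftPMet_eq h, abs_neg, abs_of_nonneg ht]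
  · rw [shiftPMet_eq h, abs_of_nonneg ht]

theorem shiftPMet_of_not_timeShifted {x y : M.GenState}
    (h : ¬ ∃ t : ℝ, 0 ≤ t ∧ TimeShifted t x y) : M.shiftPMet x y = 1 := by
  refine shiftDist_eq_one fun ⟨t, ht⟩ => h ?_
  rcases le_total 0 t with h0 | h0
  · exact ⟨t, h0, Or.inr ht⟩
  · exact ⟨-t, neg_nonneg.2 h0, Or.inl (by rwa [neg_neg])⟩

/-! ### Replacing the first configuration of a process -/

/-- Needed for almost sure statements about the initial configuration, such as `ae_seqLaw_head`. -/
instance : MeasurableSingletonClass M.Config where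
  measurableSet_singleton x := by
    obtain ⟨s, c⟩ := x
    refine MeasurableSpace.measurableSet_iInf.2 fun s' => ?_
    change MeasurableSet (Sigma.mk s' ⁻¹' {(⟨s, c⟩ : M.Config)})
    rcases eq_or_ne s' s with rfl | h
    · rw [← Set.image_singleton (f := Sigma.mk s'), Set.preimage_image_eq _ sigma_mk_injective]
      exact measurableSet_singleton c
    · rw [Set.preimage_eq_empty]
      · exact MeasurableSet.empty
      · simp [h.symm]

/-- Replace the first entry of a finite history. -/
def replaceHead (y : M.Config) (n : ℕ) (h : (_ : Finset.Iic n) → M.Config) :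
    (_ : Finset.Iic n) → M.Config :=
  fun i => if (i : ℕ) = 0 then y else h i

theorem measurable_replaceHead (y : M.Config) (n : ℕ) :
    Measurable (replaceHead (M := M) y n) := by
  refine measurable_pi_lambda _ fun i => ?_
  unfold replaceHead
  split_ifs
  · exact measurable_const
  · exact measurable_pi_apply i

/-- A history of length one more is a history followed by one draw from `historyKernel`. In integral
form, two such kernels need only be compared almost everywhere. -/
theorem lintegral_partialTraj_succ (x : (_ : Finset.Iic 0) → M.Config) (n : ℕ)
    {f : ((_ : Finset.Iic (n + 1)) → M.Config) → ℝ≥0∞} (hf : Measurable f) :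
    ∫⁻ h, f h ∂(Kernel.partialTraj (X := fun _ => M.Config) M.historyKernel 0 (n + 1) x) =
      ∫⁻ h, ∫⁻ z, f (IicProdIoc (X := fun _ => M.Config) n (n + 1)
        (h, MeasurableEquiv.piSingleton (X := fun _ => M.Config) n z)) ∂(M.historyKernel n h)
        ∂(Kernel.partialTraj (X := fun _ => M.Config) M.historyKernel 0 n x) := by
  have hm : Measurable (IicProdIoc (X := fun _ => M.Config) n (n + 1)) := measurable_IicProdIoc
  have hfm := hf.comp hm
  have hs := (MeasurableEquiv.piSingleton (X := fun _ => M.Config) n).measurable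
  have : IsMarkovKernel ((M.historyKernel n).map
      (MeasurableEquiv.piSingleton (X := fun _ => M.Config) n)) := Kernel.IsMarkovKernel.map _ hs
  rw [Kernel.partialTraj_succ_of_le (Nat.zero_le n), Kernel.lintegral_map _ hm _ hf,
    Kernel.lintegral_comp _ _ _
      (show Measurable fun a => f (IicProdIoc (X := fun _ => M.Config) n (n + 1) a)
        from hfm)]
  refine lintegral_congr fun h => ?_
  rw [Kernel.lintegral_id_prod (show Measurable fun a => f (IicProdIoc (X := fun _ => M.Config) n (n + 1) a)
        from hfm)]
  exact Kernel.lintegral_map _ hs _ (hfm.comp measurable_prodMk_left)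

theorem replaceHead_IicProdIoc (y : M.Config) (n : ℕ) (h : (_ : Finset.Iic n) → M.Config)
    (z : (_ : Finset.Ioc n (n + 1)) → M.Config) :
    replaceHead y (n + 1) (IicProdIoc (X := fun _ => M.Config) n (n + 1) (h, z)) =
      IicProdIoc (X := fun _ => M.Config) n (n + 1) (replaceHead y n h, z) := by
  funext i
  by_cases hi : (i : ℕ) = 0 <;> simp [replaceHead, IicProdIoc, hi]

/-- The transition kernel reads only the last entry of a history, so overwriting the head can affect
the first transition alone, and `hxy` says that it does not. -/
theorem partialTraj_replaceHead {x y : M.Config} (hxy : jumpLaw x = jumpLaw y) (n : ℕ) :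
    (Kernel.partialTraj (X := fun _ => M.Config) M.historyKernel 0 n fun _ => x).map
      (replaceHead y n) =
    Kernel.partialTraj (X := fun _ => M.Config) M.historyKernel 0 n fun _ => y := by
  induction n with
  | zero =>
    rw [Kernel.partialTraj_self, Kernel.id_apply, Kernel.id_apply,
      Measure.map_dirac' (measurable_replaceHead y 0)]
    congr 1
    funext i
    have : (i : ℕ) = 0 := Nat.le_zero.1 (Finset.mem_Iic.1 i.2)
    simp [replaceHead, this]
  | succ n ih =>
    -- For `n = 0` this fails for arbitrary histories, but the law is the point mass at `x`. For `n
    -- > 0` the entry that is read is not the one replaced.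
    have hκ : ∀ᵐ h ∂(Kernel.partialTraj (X := fun _ => M.Config) M.historyKernel 0 n fun _ => x),
        M.historyKernel n (replaceHead y n h) = M.historyKernel n h := by
      cases n with
      | zero =>
        rw [Kernel.partialTraj_self, Kernel.id_apply]
        rw [ae_dirac_eq]
        exact hxy.symm
      | succ n => exact ae_of_all _ fun h => rfl
    refine Measure.ext_of_lintegral _ fun f hf => ?_
    have hg : Measurable fun h : (_ : Finset.Iic n) → M.Config =>
        ∫⁻ z, f (IicProdIoc (X := fun _ => M.Config) n (n + 1)
          (h, MeasurableEquiv.piSingleton (X := fun _ => M.Config) n z))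
          ∂(M.historyKernel n h) := by
      refine Measurable.lintegral_kernel_prod_right' (f := fun p => f (IicProdIoc
        (X := fun _ => M.Config) n (n + 1)
          (p.1, MeasurableEquiv.piSingleton (X := fun _ => M.Config) n p.2))) ?_
      exact hf.comp (measurable_IicProdIoc.comp (measurable_fst.prodMk
        ((MeasurableEquiv.piSingleton (X := fun _ => M.Config) n).measurable.comp measurable_snd)))
    rw [lintegral_map hf (measurable_replaceHead y _),
      lintegral_partialTraj_succ (f := fun h => f (replaceHead y (n + 1) h)) _ _
        (hf.comp (measurable_replaceHead y _)),
      lintegral_partialTraj_succ _ _ hf, ← ih, lintegral_map hg (measurable_replaceHead y _)]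
    refine lintegral_congr_ae ?_
    filter_upwards [hκ] with h hh
    rw [hh]
    simp only [replaceHead_IicProdIoc]

/-- By `partialTraj_replaceHead` both measures have the same marginals on initial segments, and a
projective limit of finite measures is unique. -/
theorem seqLaw_map_update {x y : M.Config} (hxy : jumpLaw x = jumpLaw y) :
    (seqLaw x).map (fun w => Function.update w 0 y) = seqLaw y := by
  have hP := Kernel.isProjectiveMeasureFamily_partialTraj (X := fun _ => M.Config)
    M.historyKernel (a := 0) fun _ => y
  have (I : Finset ℕ) : IsFiniteMeasure (inducedFamily (X := fun _ => M.Config)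
      (fun b => Kernel.partialTraj (X := fun _ => M.Config) M.historyKernel 0 b fun _ => y) I) := by
    unfold inducedFamily
    infer_instance
  have hU : Measurable fun w : ℕ → M.Config => Function.update w 0 y := by fun_prop
  refine IsProjectiveLimit.unique (α := fun _ => M.Config)
    ((isProjectiveLimit_nat_iff hP _).2 fun n => ?_)
    (Kernel.isProjectiveLimit_trajFun (X := fun _ => M.Config) M.historyKernel 0 fun _ => y)
  have hr : Measurable (Preorder.frestrictLe (π := fun _ => M.Config) n) :=
    Preorder.measurable_frestrictLe n
  have e : Preorder.frestrictLe (π := fun _ => M.Config) n ∘ (fun w => Function.update w 0 y) =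
      replaceHead y n ∘ Preorder.frestrictLe (π := fun _ => M.Config) n := by
    funext w i
    by_cases hi : (i : ℕ) = 0
    · simp [replaceHead, hi]
    · simp [replaceHead, hi]
  rw [inducedFamily_Iic, ← partialTraj_replaceHead hxy, Measure.map_map hr hU, e,
    ← Measure.map_map (measurable_replaceHead y n) hr, seqLaw,
    Kernel.traj_map_frestrictLe_apply]

/-- Taking `y = x` in `seqLaw_map_update`, the law is invariant under overwriting the head by `x`,
after which the head is `x` everywhere. -/
theorem ae_seqLaw_head (x : M.Config) : ∀ᵐ w ∂(seqLaw x), w 0 = x := by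
  have hm : MeasurableSet {w : ℕ → M.Config | w 0 = x} :=
    (measurable_pi_apply 0 : Measurable fun w : ℕ → M.Config => w 0) (measurableSet_singleton x)
  rw [← seqLaw_map_update (x := x) rfl, ae_map_iff (by fun_prop) hm]
  exact ae_of_all _ fun w => Function.update_self _ _ _

/-! ### Replacing the first state of a trace -/

theorem jumpTime_update_succ (w : ℕ → M.GenState) (y : M.GenState) (n : ℕ) :
    jumpTime (Function.update w 0 y) (n + 1) =
      sojourn y.1 + ∑ j ∈ Finset.range n, sojourn (w (j + 1)).1 := by
  rw [jumpTime, Finset.sum_range_succ']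
  simp [add_comm]

/-- All jump times from the first jump on move by the same constant. -/
theorem tendsto_jumpTime_update {w : ℕ → M.GenState} (hw : Tendsto (jumpTime w) atTop atTop)
    (y : M.GenState) : Tendsto (jumpTime (Function.update w 0 y)) atTop atTop := by
  rw [← tendsto_add_atTop_iff_nat 1] at hw ⊢
  have e : (fun n => jumpTime (Function.update w 0 y) (n + 1)) =
      fun n => (sojourn y.1 - sojourn (w 0).1) + jumpTime w (n + 1) := by
    funext n
    have h := jumpTime_update_succ w (w 0) n
    rw [Function.update_eq_self] at h
    rw [jumpTime_update_succ, h]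
    ring
  rw [e]
  exact tendsto_atTop_add_const_left _ _ hw

/-- Replace the first state of a trace. -/
def Trace.setHead (y : M.GenState) (w : M.Trace) : M.Trace :=
  ⟨Function.update w.1 0 y, tendsto_jumpTime_update w.2 y⟩

theorem Trace.measurable_setHead (y : M.GenState) : Measurable (Trace.setHead (M := M) y) := by
  refine Measurable.subtype_mk (measurable_pi_lambda _ fun n => ?_)
  rcases eq_or_ne n 0 with rfl | hn
  · simp only [Function.update_self]
    exact measurable_const
  · simp only [Function.update_of_ne hn]
    exact (measurable_pi_apply n).comp measurable_subtype_coe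

theorem Trace.toSeq_setHead (y : M.GenState) (w : M.Trace) :
    (w.setHead y).toSeq = Function.update w.toSeq 0 y.1 := by
  funext n
  rcases eq_or_ne n 0 with rfl | hn
  · simp [Trace.toSeq, Trace.setHead]
  · simp [Trace.toSeq, Trace.setHead, hn]

theorem traces_map_setHead {x y : M.GenState} (hxy : jumpLaw x.1 = jumpLaw y.1) :
    (traces x).map (Trace.setHead y) = traces y := by
  ext A hA
  have hA' := Trace.measurable_setHead y hA
  rw [Measure.map_apply (Trace.measurable_setHead y) hA, traces, traces,
    measurableEmbedding_toSeq.comap_apply, measurableEmbedding_toSeq.comap_apply,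
    ← seqLaw_map_update hxy, Measure.map_apply (by fun_prop)
      (measurableEmbedding_toSeq.measurableSet_image.2 hA)]
  -- The two events agree only on sequences that start at `x.1`: otherwise the head may fail to be a
  -- generalized state, and the sequence is no trace although its update is one.
  refine measure_congr ?_
  filter_upwards [ae_seqLaw_head x.1] with w hw
  refine propext ⟨?_, ?_⟩
  · rintro ⟨v, hv, rfl⟩
    exact ⟨v.setHead y, hv, Trace.toSeq_setHead y v⟩
  · rintro ⟨v, hv, hvw⟩
    have e : (v.setHead x).toSeq = w := by
      rw [Trace.toSeq_setHead, hvw, Function.update_idem, ← hw, Function.update_eq_self]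
    refine ⟨v.setHead x, ?_, e⟩
    have : (v.setHead x).setHead y = v := by
      refine measurableEmbedding_toSeq.injective ?_
      rw [Trace.toSeq_setHead, e, hvw]
    change (v.setHead x).setHead y ∈ A
    rwa [this]

/-! ### Skorohod distance between traces that differ by a time shift of the first state -/

theorem Trace.index_eq (w : M.Trace) {t : ℝ≥0} {n : ℕ} (h1 : jumpTime w.1 n ≤ t)
    (h2 : (t : ℝ) < jumpTime w.1 (n + 1)) : w.index t = n := by
  have hmono : Monotone (jumpTime w.1) := monotone_nat_of_le_succ fun n => by
    rw [jumpTime, jumpTime, Finset.sum_range_succ]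
    linarith [sojourn_pos (w.1 n).2.hasUniqueFirst]
  obtain ⟨h3, h4⟩ := w.index_spec t
  by_contra hne
  rcases lt_or_gt_of_ne hne with h | h
  · linarith [hmono (Nat.succ_le_of_lt h)]
  · linarith [hmono (Nat.succ_le_of_lt h)]

theorem Trace.toFun_eq (w : M.Trace) {t : ℝ≥0} {n : ℕ} (h1 : jumpTime w.1 n ≤ t)
    (h2 : (t : ℝ) < jumpTime w.1 (n + 1)) :
    (w.toFun t).1 = evolve (w.1 n).1 (t - jumpTime w.1 n) := by
  simp only [Trace.toFun, w.index_eq h1 h2]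

theorem Trace.toFun_setHead_of_lt (w : M.Trace) (y : M.GenState) {t : ℝ≥0}
    (ht : (t : ℝ) < sojourn y.1) : ((w.setHead y).toFun t).1 = evolve y.1 t := by
  rw [Trace.toFun_eq (n := 0)]
  · simp [jumpTime, Trace.setHead]
  · simp [jumpTime]
  · simpa [jumpTime, Trace.setHead] using ht

/-- The sojourn at `y` is longer than that at `x` by `t`, so every jump is delayed by exactly `t`
and the same entry is current at the two times. -/
theorem Trace.toFun_setHead_shift (w : M.Trace) {x y : M.GenState} {t : ℝ≥0}
    (h : x.1 = evolve y.1 t) (τ : ℝ≥0) :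
    (w.setHead y).toFun (τ + t) = (w.setHead x).toFun τ := by
  have hs : sojourn x.1 = sojourn y.1 - t := by rw [h, sojourn_evolve]
  have hj : ∀ n, jumpTime (w.setHead y).1 (n + 1) = jumpTime (w.setHead x).1 (n + 1) + t := by
    intro n
    simp only [Trace.setHead]
    rw [jumpTime_update_succ, jumpTime_update_succ, hs]
    ring
  obtain ⟨h1, h2⟩ := (w.setHead x).index_spec τ
  apply Subtype.ext
  rw [Trace.toFun_eq _ h1 h2]
  generalize (w.setHead x).index τ = n at h1 h2
  have h2' : ((τ + t : ℝ≥0) : ℝ) < jumpTime (w.setHead y).1 (n + 1) := by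
    rw [hj]; push_cast; linarith
  cases n with
  -- Jump time `0` is not delayed; before the first jump the shift is absorbed by `evolve` instead.
  | zero =>
    rw [Trace.toFun_eq _ (n := 0)
      (by simp only [jumpTime, Finset.range_zero, Finset.sum_empty]; positivity) h2']
    simp [jumpTime, Trace.setHead, h, evolve_evolve, add_comm]
  | succ n =>
    rw [Trace.toFun_eq _ (by rw [hj]; push_cast; linarith) h2', hj]
    simp [Trace.setHead]

/-- Match time `σ` from `x` with `σ + t` from `y`: the states coincide and the times differ by `t`.
The times `τ < t` from `y` that remain are matched with `0`, at state distance at most `t - τ` and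
time distance `τ`. The bound by `1` is `skorohod_inf_le`. -/
theorem skorohod_setHead_le (w : M.Trace) {x y : M.GenState} {t : ℝ≥0}
    (h : x.1 = evolve y.1 t) :
    skorohod M.shiftPMet (w.setHead y) (w.setHead x) ≤ min 1 (t : ℝ) := by
  have h01 := skorohod_inf_le M.shiftPMet (w.setHead y) (w.setHead x)
  have hbdd : ∀ f : ℝ≥0 → ℝ, ∀ g : ℝ≥0 → ℝ, BddBelow (Set.range fun τ => max (f τ) |g τ|) :=
    fun f g => ⟨0, by rintro _ ⟨t', rfl⟩; exact le_max_of_le_right (abs_nonneg _)⟩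
  refine max_le (ciSup_le fun τ => le_min (h01.1 τ) ?_) (ciSup_le fun τ => le_min (h01.2 τ) ?_)
  · rcases le_or_gt t τ with hτ | hτ
    · obtain ⟨σ, rfl⟩ := exists_add_of_le hτ
      refine (ciInf_le (hbdd _ _) σ).trans (max_le ?_ ?_)
      · rw [add_comm, Trace.toFun_setHead_shift w h, PMet.self]
        exact t.2
      · simp
    · refine (ciInf_le (hbdd _ _) 0).trans (max_le ?_ ?_)
      · have hτ' : (τ : ℝ) < t := hτ
        have hpos := sojourn_pos x.2.hasUniqueFirst
        have hs : sojourn x.1 = sojourn y.1 - t := by rw [h, sojourn_evolve]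
        -- Positivity of the sojourn at `x` gives `t < sojourn y.1`, so no jump has occurred by time
        -- `τ`.
        have e1 := Trace.toFun_setHead_of_lt w y (t := τ) (by linarith)
        have e2 := Trace.toFun_setHead_of_lt w x (t := 0) (by simpa using hpos)
        have e3 : ((w.setHead y).toFun τ).1 = evolve ((w.setHead x).toFun 0).1 (τ - t) := by
          rw [e1, e2, h, evolve_evolve, evolve_evolve]
          congr 1
          simp
        rw [shiftPMet_eq e3]
        refine (min_le_right _ _).trans ?_
        rw [abs_of_nonpos (by linarith)]
        linarith [τ.2]
      · simpa using hτ.le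
  · refine (ciInf_le (hbdd _ _) (τ + t)).trans (max_le ?_ ?_)
    · rw [Trace.toFun_setHead_shift w h, PMet.self]
      exact t.2
    · simp

/-! ### The time-shift pseudometric is a metric bisimulation -/

theorem IsTest.abs_integral_sub_le {f : M.Trace → ℝ} (hf : IsTest (skorohod M.shiftPMet) f)
    {x y : M.GenState} {t : ℝ≥0} (h : x.1 = evolve y.1 t) :
    |∫ v, f v ∂(traces y) - ∫ v, f v ∂(traces x)| ≤ min 1 (t : ℝ) := by
  have hxy : jumpLaw x.1 = jumpLaw y.1 := by rw [h, jumpLaw_evolve y.2.hasUniqueFirst]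
  have hint : ∀ z, Integrable (fun w : M.Trace => f (w.setHead z)) (traces x) := fun z =>
    Integrable.of_bound (hf.measurable.comp (Trace.measurable_setHead z)).aestronglyMeasurable 1
      (ae_of_all _ fun w => by
        rw [Real.norm_eq_abs, abs_of_nonneg (hf.mem _).1]
        exact (hf.mem _).2)
  have hy : ∫ v, f v ∂(traces y) = ∫ w, f (w.setHead y) ∂(traces x) := by
    rw [← traces_map_setHead hxy, integral_map (Trace.measurable_setHead y).aemeasurable
      hf.measurable.aestronglyMeasurable]
  have hx : ∫ v, f v ∂(traces x) = ∫ w, f (w.setHead x) ∂(traces x) := by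
    -- Resetting the head to `x` does not change the law, and it puts both integrands in a form
    -- where the Skorohod bound holds for every `w`.
    conv_lhs => rw [← traces_map_setHead (x := x) (y := x) rfl]
    rw [integral_map (Trace.measurable_setHead x).aemeasurable
      hf.measurable.aestronglyMeasurable]
  have hmin : 0 ≤ min 1 (t : ℝ) := le_min zero_le_one t.2
  rw [hy, hx, ← integral_sub (hint y) (hint x), ← Real.norm_eq_abs]
  refine (norm_integral_le_of_norm_le_const (C := min 1 (t : ℝ)) (ae_of_all _ fun w => ?_)).trans ?_
  · exact (hf.lip _ _).trans (skorohod_setHead_le w h)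
  · refine mul_le_of_le_one_right hmin ?_
    exact ENNReal.toReal_le_of_le_ofReal zero_le_one (by simpa using traces_univ_le x)

theorem wasserstein_shiftPMet_le {x y : M.GenState} {t : ℝ} (ht : 0 ≤ t)
    (h : TimeShifted t x y) :
    wasserstein (skorohod M.shiftPMet) (traces x) (traces y) ≤ min 1 t := by
  lift t to ℝ≥0 using ht
  refine Real.iSup_le (fun f => ?_) (le_min zero_le_one t.2)
  rcases h with h | h
  -- A backward shift from `y` to `x` is a forward shift from `x` to `y`.
  · exact f.2.abs_integral_sub_le (by simpa using eq_evolve_neg h)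
  · rw [abs_sub_comm]
    exact f.2.abs_integral_sub_le h

theorem isMetricBisim_shiftPMet (k : ℝ) (hk : 0 < k ∧ k < 1) :
    IsMetricBisim k hk M.shiftPMet := by
  intro x y
  by_cases h : ∃ t : ℝ, 0 ≤ t ∧ TimeShifted t x y
  · obtain ⟨t, ht, hxy⟩ := h
    have hp : M.Props x.1.1 = M.Props y.1.1 := by
      rcases hxy with h | h <;> rw [h] <;> rfl
    rw [shiftPMet_of_timeShifted ht hxy]
    change (if M.Props x.1.1 = M.Props y.1.1 then _ else _) ≤ _
    rw [if_pos hp]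
    exact (mul_le_of_le_one_left (wasserstein_nonneg _ _ _) hk.2.le).trans
      (wasserstein_shiftPMet_le ht hxy)
  · rw [shiftPMet_of_not_timeShifted h]
    exact PMet.le_one _ _ _

end GSMP

theorem mainTheorem9 {S E AP : Type*} [Fintype S] (M : GSMP S E AP)
    (k : ℝ) (hk : 0 < k ∧ k < 1) :
    ∃ m : M.PMet,
      (∀ x y : M.GenState, ∀ t : ℝ, 0 ≤ t → GSMP.TimeShifted t x y → m x y = min 1 t) ∧
      (∀ x y : M.GenState, (¬ ∃ t : ℝ, 0 ≤ t ∧ GSMP.TimeShifted t x y) → m x y = 1) ∧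
      GSMP.IsMetricBisim k hk m ∧
      (∀ x y : M.GenState, ∀ t : ℝ, 0 ≤ t → GSMP.TimeShifted t x y →
        M.maxBisim k hk x y ≤ min 1 t) := by
  refine ⟨M.shiftPMet, fun _ _ _ => GSMP.shiftPMet_of_timeShifted,
    fun _ _ => GSMP.shiftPMet_of_not_timeShifted, GSMP.isMetricBisim_shiftPMet k hk,
    fun x y t ht h => ?_⟩
  rw [← GSMP.shiftPMet_of_timeShifted ht h]
  -- A post-fixed point lies below the greatest fixed point, and in the reversed order on `PMet`
  -- this bounds the distance from above.
  exact OrderHom.le_gfp _ (GSMP.isMetricBisim_shiftPMet k hk) x y
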